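/- Let $f$ be a meromorphic function on $\mathbb{C}$, not identically zero, whose order of growth $$\sigma=\sigma(f)=\limsup_{r\to\infty}\frac{\log^{+}T(r,f)}{\log r}$$ satisfies $\sigma<1$, where $T(r,f)$ is the Nevanlinna characteristic of $f$. Let $\eta\in\mathbb{C}$ be a fixed non-zero number, and write $\Delta f(z)=f(z+\eta)-f(z)$ and $\Delta^{k}f=\Delta(\Delta^{k-1}f)$, with $\Delta^0f=f$. Then for every $\varepsilon>0$ and every integer $k\ge 0$ there is a set $E\subset(1,\infty)$ of finite logarithmic measure, i.e. $\int_E \frac{dt}{t}<\infty$, such that for all $z\in\mathbb{C}$ with $|z|=r\notin E\cup[0,1]$ we have $f(z)\neq 0$, $f$ is analytic at $z, z+\eta,\dots,z+k\eta$, and $$\frac{\Delta^{k}f(z)}{f(z)}=\eta^{k}\,\frac{f^{(k)}(z)}{f(z)}+O\!\left(r^{(k+1)(\sigma-1)+\varepsilon}\right),$$ where the implied constant does not depend on $z$ (it may depend on $f$, $\eta$, $k$, $\varepsilon$). -/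

import Mathlib

/-- The order of growth `σ(f) = limsup_{r → ∞} log⁺ T(r, f) / log r` of a meromorphic function `f`
on the complex plane, where `T(r, f) = m(r, f) + N(r, f)` is the Nevanlinna characteristic
(`ValueDistribution.characteristic f ⊤`). It is an extended real number. -/
noncomputable def nevanlinnaOrder (f : ℂ → ℂ) : EReal :=
  Filter.limsup
    (fun r : ℝ => ((Real.posLog (ValueDistribution.characteristic f ⊤ r) / Real.log r : ℝ) : EReal))
    Filter.atTop

/-- A (measurable) set `E` of positive reals has finite logarithmic measure if
`∫_E dt / t < ∞`. -/
def HasFiniteLogMeasure (E : Set ℝ) : Prop :=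
  MeasurableSet E ∧ ∫⁻ t in E, ENNReal.ofReal (1 / t) < ⊤

open Real MeromorphicOn Metric MeasureTheory

/-! Take `s` slightly larger than `σ`, and put `r = |z|`, `Q = r ^ (1 - s)`. The heart of the proof
is `exists_forall_norm_le_mul_norm`: for `r` outside a small set, `f` (in normal form) has no zeros
or poles in the disk of radius `Q / 4` about `z`, and there `|f| ≤ M |f(z)|`. Cauchy's estimates
then bound the `n`-th Taylor coefficient at `z` by `M |f(z)| (4 / Q) ^ n`. Since `Δ^k` kills powers
below `k` and turns the `k`-th Taylor term into `η^k f^(k)(z)`, the error starts at order `k + 1`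
and is `O(Q ^ (-(k + 1)))` relative to `f(z)` (`norm_fwdDiff_iter_sub_le`).

The comparison of values comes from Poisson-Jensen on a circle of radius between `3r` and `4r`
(`log_norm_sub_log_norm_le`). The harmonic part of `log |f|` varies by `O(Q T / r)`, which is
bounded. The zeros and poles `a` contribute at most a constant plus a multiple of `Q ∑ m(a) / (1 +
|r - |a||)`. By Tonelli and Markov this sum is at most `1 / Q` off a set of finite logarithmic
measure (`exists_hasFiniteLogMeasure_forall_sum_le`); each single term of it also keeps zeros and
poles away from `z`. -/

/-! ### Variation of `log |g|` via the Poisson-Jensen formula. -/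

theorem posLog_add_posLog_inv (x : ℝ) : log⁺ x + log⁺ x⁻¹ = |log x| := by
  rw [posLog_apply, posLog_apply, log_inv]
  rcases le_total 0 (log x) with h | h
  · rw [max_eq_right h, max_eq_left (by linarith), abs_of_nonneg h, add_zero]
  · rw [max_eq_left h, max_eq_right (by linarith), abs_of_nonpos h, zero_add]

theorem abs_log_norm_sub_log_norm_le {x y : ℂ} (hy : y ≠ 0) (h : ‖x - y‖ ≤ ‖y‖ / 2) :
    |log ‖x‖ - log ‖y‖| ≤ 2 * ‖x - y‖ / ‖y‖ := by
  have hb : 0 < ‖y‖ := norm_pos_iff.2 hy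
  have h1 : ‖x‖ - ‖y‖ ≤ ‖x - y‖ := norm_sub_norm_le x y
  have h2 : ‖y‖ - ‖x‖ ≤ ‖x - y‖ := by rw [norm_sub_rev]; exact norm_sub_norm_le y x
  have ha : 0 < ‖x‖ := by linarith
  rw [abs_le]
  constructor
  · have h3 := log_le_sub_one_of_pos (div_pos hb ha)
    rw [log_div hb.ne' ha.ne'] at h3
    have h4 : ‖y‖ / ‖x‖ - 1 ≤ 2 * ‖x - y‖ / ‖y‖ := by
      rw [div_sub_one ha.ne', div_le_div_iff₀ ha hb]
      nlinarith [norm_nonneg (x - y)]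
    linarith
  · have h3 := log_le_sub_one_of_pos (div_pos ha hb)
    rw [log_div ha.ne' hb.ne'] at h3
    have h4 : ‖x‖ / ‖y‖ - 1 ≤ 2 * ‖x - y‖ / ‖y‖ := by
      rw [div_sub_one hb.ne', div_le_div_iff₀ hb hb]
      nlinarith [norm_nonneg (x - y)]
    linarith

theorem abs_log_norm_canonicalFactor_sub_le {ρ : ℝ} {a z w : ℂ} (hρ : 0 < ρ) (ha : ‖a‖ < ρ)
    (hz : ‖z‖ ≤ ρ / 2) (hw : ‖w‖ ≤ ρ / 2) (hwz : ‖w - z‖ ≤ ρ / 4) (hza : z ≠ a)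
    (hwa : ‖w - z‖ ≤ ‖z - a‖ / 2) :
    |log ‖Complex.canonicalFactor ρ a w‖ - log ‖Complex.canonicalFactor ρ a z‖|
      ≤ 4 * ‖w - z‖ / ρ + 2 * ‖w - z‖ / ‖z - a‖ := by
  have hpos : 0 < ‖z - a‖ := norm_pos_iff.2 (sub_ne_zero.2 hza)
  have key : ∀ v : ℂ, ‖v‖ ≤ ρ / 2 →
      ρ ^ 2 / 2 ≤ ‖(ρ : ℂ) ^ 2 - (starRingEnd ℂ) a * v‖ := by
    intro v hv
    have h1 := norm_sub_norm_le ((ρ : ℂ) ^ 2) ((starRingEnd ℂ) a * v)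
    rw [norm_mul, RCLike.norm_conj, norm_pow, Complex.norm_real, norm_eq_abs, sq_abs] at h1
    have h2 : ‖a‖ * ‖v‖ ≤ ρ * (ρ / 2) := mul_le_mul ha.le hv (norm_nonneg _) hρ.le
    nlinarith
  have hne : ∀ v : ℂ, ‖v‖ ≤ ρ / 2 → (ρ : ℂ) ^ 2 - (starRingEnd ℂ) a * v ≠ 0 := by
    intro v hv
    refine norm_pos_iff.1 (lt_of_lt_of_le ?_ (key v hv))
    positivity
  have hwa0 : w - a ≠ 0 := by
    intro h
    have : ‖z - a‖ = ‖w - z‖ := by rw [sub_eq_zero.1 h, norm_sub_rev]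
    linarith
  have form : ∀ v : ℂ, ‖v‖ ≤ ρ / 2 → v - a ≠ 0 → log ‖Complex.canonicalFactor ρ a v‖ =
      log ‖(ρ : ℂ) ^ 2 - (starRingEnd ℂ) a * v‖ - log ρ - log ‖v - a‖ := by
    intro v hv hva
    rw [Complex.canonicalFactor_apply, norm_div, norm_mul, Complex.norm_real, norm_eq_abs,
      abs_of_pos hρ, log_div (norm_ne_zero_iff.2 (hne v hv))
      (mul_ne_zero hρ.ne' (norm_ne_zero_iff.2 hva)), log_mul hρ.ne' (norm_ne_zero_iff.2 hva)]
    ring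
  rw [form w hw hwa0, form z hz (sub_ne_zero.2 hza)]
  have hd : ‖((ρ : ℂ) ^ 2 - (starRingEnd ℂ) a * w) - ((ρ : ℂ) ^ 2 - (starRingEnd ℂ) a * z)‖
      ≤ ρ * ‖w - z‖ := by
    rw [show ((ρ : ℂ) ^ 2 - (starRingEnd ℂ) a * w) - ((ρ : ℂ) ^ 2 - (starRingEnd ℂ) a * z)
      = (starRingEnd ℂ) a * (z - w) by ring, norm_mul, RCLike.norm_conj, norm_sub_rev z w]
    gcongr
  have h1 := abs_log_norm_sub_log_norm_le (hne z hz)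
    (x := (ρ : ℂ) ^ 2 - (starRingEnd ℂ) a * w) (by nlinarith [key z hz])
  have h2 := abs_log_norm_sub_log_norm_le (x := w - a) (sub_ne_zero.2 hza) (by simpa using hwa)
  rw [sub_sub_sub_cancel_right] at h2
  have h3 : 2 * ‖((ρ : ℂ) ^ 2 - (starRingEnd ℂ) a * w) - ((ρ : ℂ) ^ 2 - (starRingEnd ℂ) a * z)‖
      / ‖(ρ : ℂ) ^ 2 - (starRingEnd ℂ) a * z‖ ≤ 4 * ‖w - z‖ / ρ := by
    calc _ ≤ 2 * (ρ * ‖w - z‖) / (ρ ^ 2 / 2) := by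
          gcongr
          exact key z hz
      _ = 4 * ‖w - z‖ / ρ := by field_simp; ring
  rw [abs_le] at *
  constructor <;> linarith [h1.1, h1.2, h2.1, h2.2]

/-- The kernels differ by exactly `2ζ(w - z) / ((ζ - w)(ζ - z))`, and both factors below have
modulus at least `ρ / 2`. -/
theorem abs_re_herglotzRieszKernel_sub_le {ρ : ℝ} {z w ζ : ℂ} (hρ : 0 < ρ)
    (hz : ‖z‖ ≤ ρ / 2) (hw : ‖w‖ ≤ ρ / 2) (hζ : ‖ζ‖ = ρ) :
    |(herglotzRieszKernel 0 w ζ).re - (herglotzRieszKernel 0 z ζ).re| ≤ 8 * ‖w - z‖ / ρ := by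
  have key : ∀ v : ℂ, ‖v‖ ≤ ρ / 2 → ρ / 2 ≤ ‖ζ - v‖ := by
    intro v hv
    have := norm_sub_norm_le ζ v
    linarith
  have hne : ∀ v : ℂ, ‖v‖ ≤ ρ / 2 → ζ - v ≠ 0 := fun v hv =>
    norm_pos_iff.1 (lt_of_lt_of_le (by positivity) (key v hv))
  have e : herglotzRieszKernel 0 w ζ - herglotzRieszKernel 0 z ζ
      = 2 * ζ * (w - z) / ((ζ - w) * (ζ - z)) := by
    simp only [herglotzRieszKernel, sub_zero]
    rw [div_sub_div _ _ (hne w hw) (hne z hz)]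
    ring
  rw [← Complex.sub_re, e]
  refine (Complex.abs_re_le_norm _).trans ?_
  rw [norm_div, norm_mul, norm_mul, norm_mul, hζ, Complex.norm_ofNat]
  calc _ ≤ 2 * ρ * ‖w - z‖ / ((ρ / 2) * (ρ / 2)) := by
        gcongr
        · exact key w hw
        · exact key z hz
    _ = 8 * ‖w - z‖ / ρ := by field_simp; ring

/-- Subtract the Poisson integrals at `w` and `z`. The mean of `|u|` is the right quantity: for `u =
log |h|` it becomes a sum of two proximity functions. -/
theorem InnerProductSpace.HarmonicOnNhd.abs_sub_le {u : ℂ → ℝ} {ρ : ℝ} {z w : ℂ}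
    (hu : InnerProductSpace.HarmonicOnNhd u (closedBall 0 ρ)) (hρ : 0 < ρ)
    (hz : ‖z‖ ≤ ρ / 2) (hw : ‖w‖ ≤ ρ / 2) :
    |u w - u z| ≤ 8 * ‖w - z‖ / ρ * circleAverage |u| 0 ρ := by
  have hzb : z ∈ ball (0 : ℂ) ρ := by rw [mem_ball_zero_iff]; linarith
  have hwb : w ∈ ball (0 : ℂ) ρ := by rw [mem_ball_zero_iff]; linarith
  have hc : ContinuousOn u (sphere 0 |ρ|) := by
    rw [abs_of_pos hρ]; exact hu.continuousOn.mono sphere_subset_closedBall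
  have hk : ∀ v ∈ ball (0 : ℂ) ρ,
      ContinuousOn (Complex.re ∘ herglotzRieszKernel 0 v) (sphere 0 |ρ|) := fun v hv =>
    Complex.continuous_re.comp_continuousOn (continuousOn_herglotzRieszKernel_sphere hv)
  have hi : ∀ v ∈ ball (0 : ℂ) ρ,
      CircleIntegrable ((Complex.re ∘ herglotzRieszKernel 0 v) • u) 0 ρ := fun v hv =>
    ((hk v hv).smul hc).circleIntegrable'
  rw [← hu.circleAverage_re_herglotzRieszKernel_smul hzb,
    ← hu.circleAverage_re_herglotzRieszKernel_smul hwb, ← circleAverage_sub (hi w hwb) (hi z hzb)]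
  refine abs_circleAverage_le_circleAverage_abs.trans ?_
  rw [← smul_eq_mul, ← circleAverage_smul]
  have hsub : ContinuousOn ((Complex.re ∘ herglotzRieszKernel 0 w) • u
      - (Complex.re ∘ herglotzRieszKernel 0 z) • u) (sphere 0 |ρ|) :=
    ((hk w hwb).smul hc).sub ((hk z hzb).smul hc)
  refine circleAverage_mono hsub.abs.circleIntegrable'
    (hc.abs.const_smul (8 * ‖w - z‖ / ρ)).circleIntegrable' ?_
  intro ζ hζ
  have hζ' : ‖ζ‖ = ρ := by simpa [abs_of_pos hρ] using hζ
  simp only [Pi.abs_apply, Pi.sub_apply, Pi.smul_apply, smul_eq_mul, Pi.mul_apply,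
    Function.comp_apply]
  rw [← sub_mul, abs_mul]
  exact mul_le_mul_of_nonneg_right (abs_re_herglotzRieszKernel_sub_le hρ hz hw hζ') (abs_nonneg _)

/-- Difference estimate obtained from the Poisson-Jensen formula, for a circle free of zeros and
poles. -/
theorem log_norm_sub_log_norm_le {g : ℂ → ℂ} (hg : MeromorphicNFOn g Set.univ)
    {ρ : ℝ} (hρ : 0 < ρ) (hfin : ∀ z, meromorphicOrderAt g z ≠ ⊤)
    (hs : ∀ z, ‖z‖ = ρ → meromorphicOrderAt g z = 0)
    {z w : ℂ} (hz : ‖z‖ ≤ ρ / 2) (hw : ‖w‖ ≤ ρ / 2)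
    (hz0 : meromorphicOrderAt g z = 0) (hw0 : meromorphicOrderAt g w = 0)
    (hwz : ‖w - z‖ ≤ ρ / 4)
    (hsep : ∀ a, ‖a‖ < ρ → meromorphicOrderAt g a ≠ 0 → ‖w - z‖ ≤ ‖z - a‖ / 2)
    (S : Finset ℂ) (hS : ∀ a, ‖a‖ < ρ → meromorphicOrderAt g a ≠ 0 → a ∈ S) :
    |log ‖g w‖ - log ‖g z‖| ≤ 8 * ‖w - z‖ / ρ *
      (ValueDistribution.proximity g ⊤ ρ + ValueDistribution.proximity g⁻¹ ⊤ ρ)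
      + ∑ a ∈ S, |(divisor g (ball 0 ρ) a : ℝ)|
        * (4 * ‖w - z‖ / ρ + 2 * ‖w - z‖ / ‖z - a‖) := by
  have hm : Meromorphic g := fun x => (hg (Set.mem_univ x)).meromorphicAt
  have hmb : ∀ {U : Set ℂ}, MeromorphicOn g U := hm.meromorphicOn
  -- `h` is `g` with its zeros and poles in the disk cancelled by canonical factors. These are
  -- unimodular on the circle, so `|h| = |g|` there and `log |h|` is harmonic on the closed disk.
  obtain ⟨h, D⟩ := (hmb (U := closedBall 0 ρ)).exists_ecanonicalDecomp (fun u => hfin u)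
  have hdS : ∀ a, divisor g (sphere 0 ρ) a = 0 := by
    intro a
    by_cases ha : a ∈ sphere (0 : ℂ) ρ
    · rw [hmb.divisor_apply ha, hs a (by simpa using ha)]; rfl
    · exact Function.locallyFinsuppWithin.apply_eq_zero_of_notMem _ ha
  have hdB : ∀ a, divisor g (ball 0 ρ) a ≠ 0 → ‖a‖ < ρ ∧ meromorphicOrderAt g a ≠ 0 := by
    intro a ha
    have hab : a ∈ ball (0 : ℂ) ρ := (divisor g (ball 0 ρ)).supportWithinDomain ha
    refine ⟨by simpa using hab, fun h0 => ha ?_⟩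
    rw [hmb.divisor_apply hab, h0]; rfl
  have hform : ∀ v, ‖v‖ ≤ ρ → meromorphicOrderAt g v = 0 → log ‖h v‖ =
      ∑ a ∈ S, (divisor g (ball 0 ρ) a : ℝ) * log ‖Complex.canonicalFactor ρ a v‖ + log ‖g v‖ := by
    intro v hv hv0
    have hNF := hg (Set.mem_univ v)
    have hAn : AnalyticAt ℂ g v := hNF.meromorphicOrderAt_nonneg_iff_analyticAt.1 hv0.ge
    rw [D.log_norm_eq (by simpa using hv) hv0 hρ,
      hAn.meromorphicTrailingCoeffAt_of_ne_zero (hNF.meromorphicOrderAt_eq_zero_iff.1 hv0)]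
    simp only [hdS, Int.cast_zero, zero_mul, finsum_zero, sub_zero]
    congr 1
    apply finsum_eq_sum_of_support_subset
    intro a ha
    have : divisor g (ball 0 ρ) a ≠ 0 := by
      intro h0
      simp [h0] at ha
    exact hS a (hdB a this).1 (hdB a this).2
  have hharm : InnerProductSpace.HarmonicOnNhd (fun x => log ‖h x‖) (closedBall 0 ρ) :=
    fun x hx => (D.analyticOnNhd x hx).harmonicAt_log_norm (D.ne_zero x hx)
  have h1 := hharm.abs_sub_le hρ hz hw
  have hav : circleAverage |fun x => log ‖h x‖| 0 ρ
      = ValueDistribution.proximity g ⊤ ρ + ValueDistribution.proximity g⁻¹ ⊤ ρ := by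
    simp only [ValueDistribution.proximity, ↓reduceDIte]
    rw [← circleAverage_add]
    · apply circleAverage_congr_sphere
      intro x hx
      have hx' : ‖x‖ = ρ := by simpa [abs_of_pos hρ] using hx
      simp only [Pi.abs_apply, Pi.add_apply, Pi.inv_apply, norm_inv]
      rw [hform x hx'.le (hs x hx'), posLog_add_posLog_inv, Finset.sum_eq_zero, zero_add]
      intro a _
      by_cases ha : divisor g (ball 0 ρ) a = 0
      · simp [ha]
      · rw [Complex.norm_canonicalFactor_eval_circle_eq_one (by simpa using (hdB a ha).1)
          (by simpa using hx')]
        simp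
    · exact hmb.circleIntegrable_posLog_norm
    · exact hm.inv.meromorphicOn.circleIntegrable_posLog_norm
  rw [hav, hform w (by linarith) hw0, hform z (by linarith) hz0] at h1
  have h2 : |∑ a ∈ S, (divisor g (ball 0 ρ) a : ℝ) * log ‖Complex.canonicalFactor ρ a w‖
      - ∑ a ∈ S, (divisor g (ball 0 ρ) a : ℝ) * log ‖Complex.canonicalFactor ρ a z‖|
      ≤ ∑ a ∈ S, |(divisor g (ball 0 ρ) a : ℝ)|
        * (4 * ‖w - z‖ / ρ + 2 * ‖w - z‖ / ‖z - a‖) := by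
    rw [← Finset.sum_sub_distrib]
    refine (Finset.abs_sum_le_sum_abs _ _).trans (Finset.sum_le_sum fun a _ => ?_)
    rw [← mul_sub, abs_mul]
    by_cases ha : divisor g (ball 0 ρ) a = 0
    · simp [ha]
    · obtain ⟨ha1, ha2⟩ := hdB a ha
      refine mul_le_mul_of_nonneg_left ?_ (abs_nonneg _)
      refine abs_log_norm_canonicalFactor_sub_le hρ ha1 hz hw hwz ?_ (hsep a ha1 ha2)
      rintro rfl
      exact ha2 hz0
  rw [abs_le] at *
  constructor <;> linarith [h1.1, h1.2, h2.1, h2.2]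

/-! ### The exceptional set of radii. -/

/-- Dyadic summation: each index is charged to the first `j` with `t i ≤ 2 ^ j * R`, and `hcount`
makes level `j` at most a constant times `2 ^ ((p - s) * j)`. -/
theorem tsum_mul_one_add_rpow_lt_top {ι : Type*} {m t : ι → ℝ} (hm : ∀ i, 0 ≤ m i)
    (ht : ∀ i, 0 ≤ t i) {C p s R : ℝ} (hp : 0 ≤ p) (hps : p < s) (hR : 1 ≤ R) (hC : 0 ≤ C)
    (hcount : ∀ r, R ≤ r → ∀ S : Finset ι, (∀ i ∈ S, t i ≤ r) → ∑ i ∈ S, m i ≤ C * r ^ p) :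
    ∑' i, ENNReal.ofReal (m i * (1 + t i) ^ (-s)) < ⊤ := by
  have hs : 0 < s := hp.trans_lt hps
  set b : ℕ → ℝ := fun j => 2 ^ j * R with hb
  have hbR : ∀ j, R ≤ b j := fun j => le_mul_of_one_le_left (by linarith) (one_le_pow₀ one_le_two)
  set c : ℕ → ℝ := fun j => 2 ^ s * ((2 : ℝ) ^ (-s)) ^ j with hc
  have hc0 : ∀ j, 0 ≤ c j := fun j => by positivity
  have hpt : ∀ i, ENNReal.ofReal (m i * (1 + t i) ^ (-s))
      ≤ ∑' j, ENNReal.ofReal (if t i ≤ b j then m i * c j else 0) := by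
    intro i
    have hex : ∃ j, t i ≤ b j := by
      obtain ⟨j, hj⟩ := pow_unbounded_of_one_lt (t i) (one_lt_two (α := ℝ))
      exact ⟨j, hj.le.trans (le_mul_of_one_le_right (by positivity) hR)⟩
    classical
    refine le_trans ?_ (ENNReal.le_tsum (Nat.find hex))
    rw [if_pos (Nat.find_spec hex)]
    refine ENNReal.ofReal_le_ofReal (mul_le_mul_of_nonneg_left ?_ (hm i))
    rcases Nat.eq_zero_or_pos (Nat.find hex) with h0 | h0
    · rw [h0]
      simp only [hc, pow_zero, mul_one]
      exact (rpow_le_one_of_one_le_of_nonpos (by linarith [ht i]) (by linarith)).trans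
        (one_le_rpow one_le_two hs.le)
    · obtain ⟨j, hj⟩ := Nat.exists_eq_succ_of_ne_zero h0.ne'
      have h1 : ¬ t i ≤ b j := Nat.find_min hex (by omega)
      rw [hj]
      have h2 : (2 : ℝ) ^ j ≤ 1 + t i := by
        have : (2 : ℝ) ^ j ≤ 2 ^ j * R := le_mul_of_one_le_right (by positivity) hR
        have := not_le.1 h1
        simp only [hb] at this
        linarith
      calc (1 + t i) ^ (-s) ≤ ((2 : ℝ) ^ j) ^ (-s) :=
            rpow_le_rpow_of_nonpos (by positivity) h2 (by linarith)
        _ = c (j + 1) := by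
            simp only [hc]
            rw [pow_succ, ← rpow_natCast, ← rpow_natCast, ← rpow_mul two_pos.le,
              ← rpow_mul two_pos.le, ← rpow_add two_pos, ← rpow_add two_pos]
            congr 1; ring
  refine (ENNReal.tsum_le_tsum hpt).trans_lt ?_
  rw [ENNReal.tsum_comm]
  have hsum : ∀ j, ∑' i, ENNReal.ofReal (if t i ≤ b j then m i * c j else 0)
      ≤ ENNReal.ofReal (C * R ^ p * 2 ^ s * ((2 : ℝ) ^ (p - s)) ^ j) := by
    intro j
    rw [ENNReal.tsum_eq_iSup_sum]
    refine iSup_le fun S => ?_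
    rw [← ENNReal.ofReal_sum_of_nonneg
      (fun i _ => by split_ifs; exacts [mul_nonneg (hm i) (hc0 j), le_rfl])]
    refine ENNReal.ofReal_le_ofReal ?_
    rw [← Finset.sum_filter, ← Finset.sum_mul]
    calc _ ≤ C * (b j) ^ p * c j := by
          refine mul_le_mul_of_nonneg_right ?_ (hc0 j)
          exact hcount _ (hbR j) _ (fun i hi => (Finset.mem_filter.1 hi).2)
      _ = _ := by
          simp only [hb, hc]
          rw [mul_rpow (by positivity) (by linarith), ← rpow_natCast, ← rpow_natCast,
            ← rpow_natCast, ← rpow_mul two_pos.le, ← rpow_mul two_pos.le, ← rpow_mul two_pos.le]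
          have : (2 : ℝ) ^ ((p - s) * (j : ℝ)) = 2 ^ ((j : ℝ) * p) * 2 ^ (-s * (j : ℝ)) := by
            rw [← rpow_add two_pos]; congr 1; ring
          rw [this]; ring
  refine (ENNReal.tsum_le_tsum hsum).trans_lt ?_
  have hsm : Summable fun j : ℕ => C * R ^ p * 2 ^ s * ((2 : ℝ) ^ (p - s)) ^ j :=
    (summable_geometric_of_lt_one (by positivity)
      (rpow_lt_one_of_one_lt_of_neg one_lt_two (by linarith))).mul_left _
  rw [← ENNReal.ofReal_tsum_of_nonneg (fun j => by
    have : 0 ≤ R ^ p := rpow_nonneg (by linarith) _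
    positivity) hsm]
  exact ENNReal.ofReal_lt_top

theorem rpow_neg_mul_inv_le {u v q : ℝ} (hu : 0 < u) (hv : 0 < v) (hq : 0 < q) :
    u ^ (-q) * v⁻¹ ≤ u ^ (-(1 + q)) + v ^ (-(1 + q)) := by
  have e : ∀ x : ℝ, 0 < x → x ^ (-(1 + q)) = x ^ (-q) * x⁻¹ := by
    intro x hx
    rw [show -(1 + q) = -q + -1 by ring, rpow_add hx, rpow_neg_one]
  rw [e u hu, e v hv]
  rcases le_total u v with h | h
  · have : u ^ (-q) * v⁻¹ ≤ u ^ (-q) * u⁻¹ := by gcongr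
    have : 0 ≤ v ^ (-q) * v⁻¹ := by positivity
    linarith
  · have : u ^ (-q) * v⁻¹ ≤ v ^ (-q) * v⁻¹ :=
      mul_le_mul_of_nonneg_right (rpow_le_rpow_of_nonpos hv h (by linarith)) (by positivity)
    have : 0 ≤ u ^ (-q) * u⁻¹ := by positivity
    linarith

/-- On the domain `1 + t ≤ 5r`, so `r ^ (-(s - q))` yields the decay in `t`. The remaining `r ^
(-q)` is spent on making `1 / (1 + |r - t|)` integrable, through `rpow_neg_mul_inv_le`. -/
theorem lintegral_rpow_div_one_add_abs_sub_le {s q : ℝ} (hq : 0 < q) (hsq : 0 ≤ s - q) :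
    ∃ K : ENNReal, K < ⊤ ∧ ∀ t : ℝ, 0 ≤ t →
      ∫⁻ r in Set.Ioi 1, ENNReal.ofReal (if t ≤ 4 * r then r ^ (-s) / (1 + |r - t|) else 0)
        ≤ ENNReal.ofReal ((1 + t) ^ (-(s - q))) * K := by
  have hint : Integrable (fun x : ℝ => (1 + ‖x‖) ^ (-(1 + q))) :=
    integrable_one_add_norm (by simp; linarith)
  set J : ENNReal := ∫⁻ x : ℝ, ENNReal.ofReal ((1 + |x|) ^ (-(1 + q))) with hJ
  have hJt : J < ⊤ := by
    simpa only [Real.norm_eq_abs] using hint.lintegral_lt_top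
  refine ⟨ENNReal.ofReal (5 ^ (s - q) * 2 ^ q) * (J + J), ENNReal.mul_lt_top
    ENNReal.ofReal_lt_top (ENNReal.add_lt_top.2 ⟨hJt, hJt⟩), fun t ht => ?_⟩
  have hshift : ∫⁻ r : ℝ, ENNReal.ofReal ((1 + |r - t|) ^ (-(1 + q))) = J :=
    lintegral_sub_right_eq_self (fun x : ℝ => ENNReal.ofReal ((1 + |x|) ^ (-(1 + q)))) t
  have hpt : ∀ r ∈ Set.Ioi (1 : ℝ),
      ENNReal.ofReal (if t ≤ 4 * r then r ^ (-s) / (1 + |r - t|) else 0)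
      ≤ ENNReal.ofReal ((1 + t) ^ (-(s - q)) * (5 ^ (s - q) * 2 ^ q)) *
        (ENNReal.ofReal ((1 + |r|) ^ (-(1 + q))) + ENNReal.ofReal ((1 + |r - t|) ^ (-(1 + q)))) := by
    intro r hr
    have hr1 : 1 < r := hr
    have hr0 : 0 < r := by linarith
    rw [← ENNReal.ofReal_add (by positivity) (by positivity), ← ENNReal.ofReal_mul (by positivity)]
    refine ENNReal.ofReal_le_ofReal ?_
    split_ifs with h
    · rw [abs_of_pos hr0]
      have h1 : r ^ (-(s - q)) ≤ (1 + t) ^ (-(s - q)) * 5 ^ (s - q) := by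
        have : r ^ (-(s - q)) ≤ ((1 + t) / 5) ^ (-(s - q)) :=
          rpow_le_rpow_of_nonpos (by positivity) (by linarith) (by linarith)
        refine this.trans_eq ?_
        rw [div_rpow (by positivity) (by positivity), rpow_neg (by norm_num : (0:ℝ) ≤ 5),
          div_inv_eq_mul]
      have h2 : r ^ (-q) ≤ 2 ^ q * (1 + r) ^ (-q) := by
        have : r ^ (-q) ≤ ((1 + r) / 2) ^ (-q) :=
          rpow_le_rpow_of_nonpos (by positivity) (by linarith) (by linarith)
        refine this.trans_eq ?_
        rw [div_rpow (by positivity) (by positivity), rpow_neg (by norm_num : (0:ℝ) ≤ 2),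
          div_inv_eq_mul, mul_comm]
      have h3 := rpow_neg_mul_inv_le (u := 1 + r) (v := 1 + |r - t|) (by positivity)
        (by positivity) hq
      calc r ^ (-s) / (1 + |r - t|) = r ^ (-(s - q)) * (r ^ (-q) * (1 + |r - t|)⁻¹) := by
            rw [div_eq_mul_inv, ← mul_assoc, ← rpow_add hr0]; congr 2; ring
        _ ≤ ((1 + t) ^ (-(s - q)) * 5 ^ (s - q)) *
              (2 ^ q * (1 + r) ^ (-q) * (1 + |r - t|)⁻¹) := by gcongr
        _ = ((1 + t) ^ (-(s - q)) * (5 ^ (s - q) * 2 ^ q)) *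
              ((1 + r) ^ (-q) * (1 + |r - t|)⁻¹) := by ring
        _ ≤ _ := by gcongr
    · positivity
  calc _ ≤ ∫⁻ r in Set.Ioi 1, ENNReal.ofReal ((1 + t) ^ (-(s - q)) * (5 ^ (s - q) * 2 ^ q)) *
        (ENNReal.ofReal ((1 + |r|) ^ (-(1 + q))) + ENNReal.ofReal ((1 + |r - t|) ^ (-(1 + q)))) :=
        setLIntegral_mono' measurableSet_Ioi hpt
    _ ≤ ∫⁻ r, ENNReal.ofReal ((1 + t) ^ (-(s - q)) * (5 ^ (s - q) * 2 ^ q)) *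
        (ENNReal.ofReal ((1 + |r|) ^ (-(1 + q))) + ENNReal.ofReal ((1 + |r - t|) ^ (-(1 + q)))) :=
        setLIntegral_le_lintegral _ _
    _ = _ := by
        rw [lintegral_const_mul _ (by fun_prop), lintegral_add_left (by fun_prop), hshift,
          ENNReal.ofReal_mul (by positivity), mul_assoc]

/-- A discrete mass distribution with polynomial growth has small potential outside a set of
finite logarithmic measure. -/
theorem exists_hasFiniteLogMeasure_forall_sum_le {ι : Type*} [Countable ι] {m t : ι → ℝ}
    (hm : ∀ i, 0 ≤ m i) (ht : ∀ i, 0 ≤ t i) {C p q R : ℝ} (hp : 0 ≤ p) (hq : 0 < q) (hR : 1 ≤ R)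
    (hC : 0 ≤ C)
    (hcount : ∀ r, R ≤ r → ∀ S : Finset ι, (∀ i ∈ S, t i ≤ r) → ∑ i ∈ S, m i ≤ C * r ^ p) :
    ∃ E ⊆ Set.Ioi (1 : ℝ), HasFiniteLogMeasure E ∧ ∀ r, 1 < r → r ∉ E → ∀ S : Finset ι,
      (∀ i ∈ S, t i ≤ 4 * r) → ∑ i ∈ S, m i / (1 + |r - t i|) ≤ r ^ (p + 2 * q - 1) := by
  set k : ι → ℝ → ℝ := fun i r =>
    if t i ≤ 4 * r then r ^ (-(p + 2 * q)) / (1 + |r - t i|) else 0 with hk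
  have hkm : ∀ i, Measurable (k i) := by
    intro i
    exact Measurable.ite (measurableSet_le measurable_const (by fun_prop)) (by fun_prop)
      measurable_const
  set F : ℝ → ENNReal := fun r => ∑' i, ENNReal.ofReal (m i) * ENNReal.ofReal (k i r) with hF
  have hFm : Measurable F :=
    Measurable.tsum fun i => ((hkm i).ennreal_ofReal).const_mul _
  -- Markov's inequality against `dr / r`: on this set `1 / r < F r`, and `F` is integrable. Of the
  -- `2 * q` in the weight, one `q` pays for the integral in `r`, the other for the sum over `i`.
  refine ⟨Set.Ioi 1 ∩ {r | ENNReal.ofReal (1 / r) < F r}, Set.inter_subset_left,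
    ⟨measurableSet_Ioi.inter (measurableSet_lt (by fun_prop) hFm), ?_⟩, ?_⟩
  · obtain ⟨K, hK, hKt⟩ := lintegral_rpow_div_one_add_abs_sub_le (s := p + 2 * q) hq (by linarith)
    have hmE : MeasurableSet (Set.Ioi 1 ∩ {r | ENNReal.ofReal (1 / r) < F r}) :=
      measurableSet_Ioi.inter (measurableSet_lt (by fun_prop) hFm)
    calc _ ≤ ∫⁻ r in Set.Ioi 1 ∩ {r | ENNReal.ofReal (1 / r) < F r}, F r :=
          setLIntegral_mono' hmE fun r hr => hr.2.le
      _ ≤ ∫⁻ r in Set.Ioi 1, F r := lintegral_mono_set Set.inter_subset_left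
      _ = ∑' i, ENNReal.ofReal (m i) * ∫⁻ r in Set.Ioi 1, ENNReal.ofReal (k i r) := by
          simp only [hF]
          rw [lintegral_tsum fun i => (((hkm i).ennreal_ofReal).const_mul _).aemeasurable]
          exact tsum_congr fun i => lintegral_const_mul _ (hkm i).ennreal_ofReal
      _ ≤ ∑' i, ENNReal.ofReal (m i * (1 + t i) ^ (-(p + 2 * q - q))) * K := by
          refine ENNReal.tsum_le_tsum fun i => ?_
          rw [ENNReal.ofReal_mul (hm i), mul_assoc]
          exact mul_le_mul_right (hKt (t i) (ht i)) _
      _ < ⊤ := by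
          rw [ENNReal.tsum_mul_right]
          exact ENNReal.mul_lt_top (tsum_mul_one_add_rpow_lt_top hm ht hp (by linarith) hR hC
            hcount) hK
  · intro r hr hrE S hS
    have hr0 : 0 < r := by linarith
    have h1 : F r ≤ ENNReal.ofReal (1 / r) := not_lt.1 fun h => hrE ⟨hr, h⟩
    have h2 := (ENNReal.sum_le_tsum (f := fun i => ENNReal.ofReal (m i) * ENNReal.ofReal (k i r))
      S).trans h1
    have h3 : ENNReal.ofReal (∑ i ∈ S, m i * k i r) ≤ ENNReal.ofReal (1 / r) := by
      rw [ENNReal.ofReal_sum_of_nonneg]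
      · simpa only [ENNReal.ofReal_mul (hm _)] using h2
      · intro i _
        refine mul_nonneg (hm i) ?_
        simp only [hk]
        split_ifs <;> positivity
    rw [ENNReal.ofReal_le_ofReal_iff (by positivity)] at h3
    have h4 : ∑ i ∈ S, m i * k i r = r ^ (-(p + 2 * q)) * ∑ i ∈ S, m i / (1 + |r - t i|) := by
      rw [Finset.mul_sum]
      refine Finset.sum_congr rfl fun i hi => ?_
      simp only [hk, if_pos (hS i hi)]
      ring
    rw [h4, rpow_neg hr0.le, inv_mul_le_iff₀ (by positivity)] at h3
    rwa [rpow_sub_one hr0.ne', div_eq_mul_one_div]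

/-! ### Counting zeros and poles by the characteristic. -/

/-- The number of points in a disk is controlled by the logarithmic counting function at twice
the radius. -/
theorem sum_mul_log_two_le_logCounting {A : Function.locallyFinsupp ℂ ℤ} (hA : 0 ≤ A) {r : ℝ}
    (hr : 1 ≤ r) (S : Finset ℂ) (hS : ∀ a ∈ S, ‖a‖ ≤ r) :
    (∑ a ∈ S, (A a : ℝ)) * log 2 ≤ A.logCounting (2 * r) := by
  classical
  have hA' : ∀ a, (0 : ℝ) ≤ A a := fun a => by exact_mod_cast hA a
  set B := Function.locallyFinsuppWithin.toClosedBall (2 * r) A with hB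
  have hBA : ∀ a : ℂ, ‖a‖ ≤ 2 * r → B a = A a := fun a ha =>
    Function.locallyFinsuppWithin.toClosedBall_eval_within A (by
      rw [mem_closedBall_zero_iff, abs_of_pos (by linarith)]; exact ha)
  have hBfin : B.support.Finite := B.finiteSupport (isCompact_closedBall _ _)
  set T : Finset ℂ := insert 0 (hBfin.toFinset ∪ S) with hT
  have hlog : ∀ a : ℂ, a ≠ 0 → ‖a‖ ≤ 2 * r → 0 ≤ log (2 * r * ‖a‖⁻¹) := by
    intro a ha h
    have : 0 < ‖a‖ := norm_pos_iff.2 ha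
    exact log_nonneg (by rw [← div_eq_mul_inv, le_div_iff₀ this]; linarith)
  -- At `a = 0` the first term vanishes because `0⁻¹ = 0` and `log 0 = 0`; the origin is counted
  -- only by the second term.
  set G : ℂ → ℝ := fun a => B a * log (2 * r * ‖a‖⁻¹) + if a = 0 then A 0 * log (2 * r) else 0
    with hG
  have hlc : A.logCounting (2 * r) = ∑ a ∈ T, G a := by
    have h1 : ∑ᶠ a, (B a : ℝ) * log (2 * r * ‖a‖⁻¹) = ∑ a ∈ T, (B a : ℝ) * log (2 * r * ‖a‖⁻¹) := by
      apply finsum_eq_sum_of_support_subset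
      intro a ha
      have : B a ≠ 0 := by
        intro h0
        simp [h0] at ha
      simp [hT, this]
    have h2 : ∑ a ∈ T, (if a = 0 then (A 0 : ℝ) * log (2 * r) else 0) = A 0 * log (2 * r) := by
      rw [Finset.sum_ite_eq' T (0 : ℂ) (fun _ => (A 0 : ℝ) * log (2 * r))]
      simp [hT]
    simp only [hG]
    rw [Finset.sum_add_distrib, h2, ← h1]
    rfl
  have hlog2r : log 2 ≤ log (2 * r) := log_le_log two_pos (by linarith)
  have hlog2 : 0 ≤ log 2 := log_nonneg one_le_two
  have hG0 : ∀ a, 0 ≤ G a := by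
    intro a
    simp only [hG]
    by_cases ha : a = 0
    · subst ha
      simp only [norm_zero, inv_zero, mul_zero, log_zero, if_true, zero_add]
      exact mul_nonneg (hA' 0) (hlog2.trans hlog2r)
    · rw [if_neg ha, add_zero]
      by_cases h : ‖a‖ ≤ 2 * r
      · rw [hBA a h]
        exact mul_nonneg (hA' a) (hlog a ha h)
      · rw [Function.locallyFinsuppWithin.apply_eq_zero_of_notMem]
        · simp
        · rw [mem_closedBall_zero_iff, abs_of_pos (by linarith)]; exact h
  rw [hlc, Finset.sum_mul]
  calc ∑ a ∈ S, (A a : ℝ) * log 2 ≤ ∑ a ∈ S, G a := by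
        refine Finset.sum_le_sum fun a ha => ?_
        simp only [hG]
        by_cases h0 : a = 0
        · subst h0
          simp only [norm_zero, inv_zero, mul_zero, log_zero, if_true, zero_add]
          exact mul_le_mul_of_nonneg_left hlog2r (hA' 0)
        · have hpos : 0 < ‖a‖ := norm_pos_iff.2 h0
          rw [if_neg h0, add_zero, hBA a (by linarith [hS a ha])]
          refine mul_le_mul_of_nonneg_left (log_le_log two_pos ?_) (hA' a)
          rw [← div_eq_mul_inv, le_div_iff₀ hpos]
          linarith [hS a ha]
    _ ≤ ∑ a ∈ T, G a := Finset.sum_le_sum_of_subset_of_nonneg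
        (fun a ha => Finset.mem_insert_of_mem (Finset.mem_union_right _ ha)) fun a _ _ => hG0 a

/-- Jensen's formula: the characteristics of `g` and `g⁻¹` differ by a constant. -/
theorem characteristic_add_characteristic_inv_le {g : ℂ → ℂ} (hg : Meromorphic g) {r : ℝ}
    (hr : r ≠ 0) :
    ValueDistribution.characteristic g ⊤ r + ValueDistribution.characteristic g⁻¹ ⊤ r
      ≤ 2 * ValueDistribution.characteristic g ⊤ r + |log ‖meromorphicTrailingCoeffAt g 0‖| := by
  have := ValueDistribution.characteristic_sub_characteristic_inv_of_ne_zero hg hr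
  have := neg_abs_le (log ‖meromorphicTrailingCoeffAt g 0‖)
  linarith

theorem proximity_add_proximity_inv_le {g : ℂ → ℂ} (hg : Meromorphic g) {r : ℝ} (hr : 1 ≤ r) :
    ValueDistribution.proximity g ⊤ r + ValueDistribution.proximity g⁻¹ ⊤ r
      ≤ 2 * ValueDistribution.characteristic g ⊤ r + |log ‖meromorphicTrailingCoeffAt g 0‖| := by
  refine le_trans ?_ (characteristic_add_characteristic_inv_le hg (by linarith))
  simp only [ValueDistribution.characteristic, Pi.add_apply]
  have := ValueDistribution.logCounting_nonneg (f := g) (e := ⊤) hr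
  have := ValueDistribution.logCounting_nonneg (f := g⁻¹) (e := ⊤) hr
  linarith

theorem sum_abs_divisor_mul_log_two_le {g : ℂ → ℂ} (hg : Meromorphic g) {r : ℝ} (hr : 1 ≤ r)
    (S : Finset ℂ) (hS : ∀ a ∈ S, ‖a‖ ≤ r) :
    (∑ a ∈ S, |(divisor g Set.univ a : ℝ)|) * log 2
      ≤ 2 * ValueDistribution.characteristic g ⊤ (2 * r)
        + |log ‖meromorphicTrailingCoeffAt g 0‖| := by
  refine le_trans ?_ (characteristic_add_characteristic_inv_le hg (by linarith))
  have h := sum_mul_log_two_le_logCounting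
    (add_nonneg (posPart_nonneg (divisor g Set.univ)) (negPart_nonneg (divisor g Set.univ))) hr S hS
  have e : ∀ a, (((divisor g Set.univ)⁺ + (divisor g Set.univ)⁻) a : ℤ)
      = |divisor g Set.univ a| := by
    intro a
    rw [Function.locallyFinsuppWithin.coe_add, Pi.add_apply,
      Function.locallyFinsuppWithin.posPart_apply, Function.locallyFinsuppWithin.negPart_apply]
    exact posPart_add_negPart _
  simp only [e, Int.cast_abs] at h
  refine h.trans ?_
  rw [map_add, ← ValueDistribution.logCounting_zero, ← ValueDistribution.logCounting_top,
    ← ValueDistribution.logCounting_inv]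
  simp only [ValueDistribution.characteristic, Pi.add_apply]
  have := ValueDistribution.proximity_nonneg (f := g) (a := ⊤) (2 * r)
  have := ValueDistribution.proximity_nonneg (f := g⁻¹) (a := ⊤) (2 * r)
  simp only [Pi.zero_apply] at *
  linarith

/-! ### Iterated differences and Taylor expansion. -/

/-- Comparison of an iterated difference with the derivative, from the Taylor expansion. -/
theorem norm_fwdDiff_iter_sub_le {g : ℂ → ℂ} {z η : ℂ} {R M : ℝ} (k : ℕ) (hR : 0 < R)
    (hg : DiffContOnCl ℂ g (ball z R)) (hM : ∀ w ∈ sphere z R, ‖g w‖ ≤ M)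
    (hkη : k * ‖η‖ ≤ R / 2) :
    ‖(fwdDiff η)^[k] g z - η ^ k * iteratedDeriv k g z‖
      ≤ 2 ^ (k + 1) * M * (k * ‖η‖ / R) ^ (k + 1) := by
  obtain ⟨w₀, hw₀⟩ : (sphere z R).Nonempty := NormedSpace.sphere_nonempty.2 hR.le
  have hM0 : 0 ≤ M := (norm_nonneg _).trans (hM w₀ hw₀)
  set x : ℝ := k * ‖η‖ / R with hx
  have hx0 : 0 ≤ x := by positivity
  have hx1 : x ≤ 1 / 2 := by rw [hx, div_le_iff₀ hR]; linarith
  set c : ℕ → ℂ := fun n => (n.factorial : ℂ)⁻¹ * iteratedDeriv n g z with hc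
  have hcn : ∀ n, ‖c n‖ ≤ M / R ^ n := by
    intro n
    have h := Complex.norm_iteratedDeriv_le_of_forall_mem_sphere_norm_le n hR hg hM
    have hf : (0 : ℝ) < n.factorial := by exact_mod_cast n.factorial_pos
    simp only [hc, norm_mul, norm_inv, RCLike.norm_natCast]
    rw [inv_mul_le_iff₀ hf, ← mul_div_assoc]
    exact h
  set e : ℕ → ℂ := fun j => (((-1 : ℤ) ^ (k - j) * (k.choose j : ℤ) : ℤ) : ℂ) with he
  -- `d n` is the `k`-th unit-step difference of `x ^ n` at `0`: it vanishes for `n < k` and equals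
  -- `k!` for `n = k`.
  set d : ℕ → ℂ := fun n => ∑ j ∈ Finset.range (k + 1), e j * (j : ℂ) ^ n with hd
  have hdfwd : ∀ n, d n = (fwdDiff (1 : ℂ))^[k] (fun r => r ^ n) 0 := by
    intro n
    rw [fwdDiff_iter_eq_sum_shift]
    simp [hd, he]
  have hdlt : ∀ n, n < k → d n = 0 := by
    intro n hn
    rw [hdfwd, fwdDiff_iter_pow_eq_zero_of_lt hn]; rfl
  have hdk : d k = k.factorial := by
    rw [hdfwd, fwdDiff_iter_eq_factorial]; rfl
  have hsumc : ∑ j ∈ Finset.range (k + 1), ‖e j‖ = 2 ^ k := by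
    simp only [he, Int.cast_mul, Int.cast_pow, Int.cast_neg, Int.cast_one, Int.cast_natCast,
      norm_mul, norm_pow, norm_neg, norm_one, one_pow, one_mul, RCLike.norm_natCast]
    exact_mod_cast Nat.sum_range_choose k
  have hdn : ∀ n, ‖d n‖ ≤ 2 ^ k * (k : ℝ) ^ n := by
    intro n
    rw [← hsumc, Finset.sum_mul]
    refine (norm_sum_le _ _).trans (Finset.sum_le_sum fun j hj => ?_)
    rw [norm_mul, norm_pow, RCLike.norm_natCast]
    have : (j : ℝ) ≤ k := by exact_mod_cast Nat.lt_succ_iff.1 (Finset.mem_range.1 hj)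
    gcongr
  have hTaylor : ∀ j ∈ Finset.range (k + 1),
      HasSum (fun n => e j * (c n * (j * η) ^ n)) (e j * g (z + j • η)) := by
    intro j hj
    have hj' : (j : ℝ) ≤ k := by exact_mod_cast Nat.lt_succ_iff.1 (Finset.mem_range.1 hj)
    have hmem : z + j • η ∈ ball z R := by
      rw [mem_ball_iff_norm, add_sub_cancel_left, nsmul_eq_mul, norm_mul, RCLike.norm_natCast]
      have : (j : ℝ) * ‖η‖ ≤ k * ‖η‖ := by gcongr
      linarith
    have h := (Complex.hasSum_taylorSeries_on_ball hg.differentiableOn hmem).mul_left (e j)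
    refine h.congr_fun ?_
    intro n
    simp only [hc, smul_eq_mul, add_sub_cancel_left, nsmul_eq_mul]
    ring
  have hall : HasSum (fun n => c n * η ^ n * d n) ((fwdDiff η)^[k] g z) := by
    rw [fwdDiff_iter_eq_sum_shift]
    have h := hasSum_sum hTaylor
    simp only [zsmul_eq_mul]
    convert h using 2 with n
    simp only [hd, Finset.mul_sum]
    refine Finset.sum_congr rfl fun j _ => ?_
    rw [mul_pow]; ring
  have htail := (hasSum_nat_add_iff' (k + 1)).2 hall
  have hhead : ∑ n ∈ Finset.range (k + 1), c n * η ^ n * d n = η ^ k * iteratedDeriv k g z := by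
    rw [Finset.sum_range_succ, Finset.sum_eq_zero, zero_add, hdk]
    · have : (k.factorial : ℂ) ≠ 0 := by exact_mod_cast k.factorial_ne_zero
      simp only [hc]
      field_simp
    · intro n hn
      rw [hdlt n (Finset.mem_range.1 hn), mul_zero]
  rw [hhead] at htail
  have hgeo : HasSum (fun n : ℕ => 2 ^ k * M * x ^ (k + 1) * (1 / 2 : ℝ) ^ n)
      (2 ^ k * M * x ^ (k + 1) * 2) := hasSum_geometric_two.mul_left _
  refine (htail.norm_le_of_bounded hgeo fun n => ?_).trans_eq (by ring)
  rw [norm_mul, norm_mul, norm_pow]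
  calc ‖c (n + (k + 1))‖ * ‖η‖ ^ (n + (k + 1)) * ‖d (n + (k + 1))‖
      ≤ M / R ^ (n + (k + 1)) * ‖η‖ ^ (n + (k + 1)) * (2 ^ k * (k : ℝ) ^ (n + (k + 1))) := by
        gcongr
        · exact hcn _
        · exact hdn _
    _ = 2 ^ k * M * x ^ (k + 1) * x ^ n := by
        rw [mul_assoc _ (x ^ (k + 1)), ← pow_add, add_comm (k + 1) n, hx, div_pow, mul_pow]
        field_simp
    _ ≤ _ := by gcongr

/-! ### Local comparability of values off the exceptional set. -/

theorem locallyFinsupp_countable_support (D : Function.locallyFinsupp ℂ ℤ) :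
    D.support.Countable :=
  (HereditarilyLindelofSpace.isLindelof _).countable_of_isDiscrete D.discreteSupport

theorem divisor_ne_zero_iff {g : ℂ → ℂ} (hg : Meromorphic g)
    (hfin : ∀ z, meromorphicOrderAt g z ≠ ⊤) (a : ℂ) :
    divisor g Set.univ a ≠ 0 ↔ meromorphicOrderAt g a ≠ 0 := by
  rw [hg.meromorphicOn.divisor_apply (Set.mem_univ a)]
  simp [hfin a]

theorem exists_sphere_meromorphicOrderAt_eq_zero {g : ℂ → ℂ} (hg : Meromorphic g)
    (hfin : ∀ z, meromorphicOrderAt g z ≠ ⊤) {x y : ℝ} (hxy : x < y) :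
    ∃ ρ ∈ Set.Ioo x y, ∀ z, ‖z‖ = ρ → meromorphicOrderAt g z = 0 := by
  have hc : ((fun z : ℂ => ‖z‖) '' (divisor g Set.univ).support).Countable :=
    (locallyFinsupp_countable_support _).image _
  obtain ⟨ρ, hρ, hρxy⟩ := (hc.dense_compl ℝ).exists_between hxy
  refine ⟨ρ, hρxy, fun z hz => ?_⟩
  by_contra h
  exact hρ ⟨z, (divisor_ne_zero_iff hg hfin z).2 h, hz⟩

set_option maxHeartbeats 1000000 in
/-- Outside a set of radii of finite logarithmic measure, a meromorphic function of order less
than one has neither zeros nor poles near `z` and is there comparable with its value at `z`. -/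
theorem exists_forall_norm_le_mul_norm {g : ℂ → ℂ} (hg : MeromorphicNFOn g Set.univ)
    (hfin : ∀ z, meromorphicOrderAt g z ≠ ⊤) {p q r₀ : ℝ} (hp : 0 ≤ p) (hq : 0 < q)
    (hpq : p + 2 * q < 1)
    (hT : ∀ r, r₀ ≤ r → ValueDistribution.characteristic g ⊤ r ≤ r ^ p) :
    ∃ E ⊆ Set.Ioi (1 : ℝ), HasFiniteLogMeasure E ∧ ∃ M r₁ : ℝ, ∀ z : ℂ, r₁ ≤ ‖z‖ → ‖z‖ ∉ E →
      ∀ w, ‖w - z‖ ≤ ‖z‖ ^ (1 - (p + 2 * q)) / 4 →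
        meromorphicOrderAt g w = 0 ∧ ‖g w‖ ≤ M * ‖g z‖ := by
  classical
  have hm : Meromorphic g := fun x => (hg (Set.mem_univ x)).meromorphicAt
  set D := divisor g Set.univ with hD
  have hDne := divisor_ne_zero_iff hm hfin
  set K : ℝ := |log ‖meromorphicTrailingCoeffAt g 0‖| with hK
  have hK0 : 0 ≤ K := abs_nonneg _
  have hl2 : 0 < log 2 := log_pos one_lt_two
  set R : ℝ := max r₀ 1 with hR
  have hR1 : 1 ≤ R := le_max_right _ _
  set C : ℝ := (2 * 2 ^ p + K) / log 2 with hC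
  have hC0 : 0 ≤ C := by positivity
  have hcount : ∀ r, R ≤ r → ∀ S : Finset ℂ, (∀ a ∈ S, ‖a‖ ≤ r) →
      ∑ a ∈ S, |(D a : ℝ)| ≤ C * r ^ p := by
    intro r hr S hS
    have hr1 : 1 ≤ r := hR1.trans hr
    have h1 := sum_abs_divisor_mul_log_two_le hm hr1 S hS
    have h2 := hT (2 * r) (by linarith [le_max_left r₀ 1])
    rw [mul_rpow two_pos.le (by linarith)] at h2
    have h3 : 1 ≤ r ^ p := one_le_rpow hr1 hp
    rw [hC, div_mul_eq_mul_div, le_div_iff₀ hl2]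
    nlinarith
  obtain ⟨E, hE1, hE, hEsum⟩ : ∃ E ⊆ Set.Ioi (1 : ℝ), HasFiniteLogMeasure E ∧ ∀ r, 1 < r → r ∉ E →
      ∀ S : Finset D.support, (∀ i ∈ S, ‖(i : ℂ)‖ ≤ 4 * r) →
        ∑ i ∈ S, |(D i : ℝ)| / (1 + |r - ‖(i : ℂ)‖|) ≤ r ^ (p + 2 * q - 1) := by
    have : Countable D.support := (locallyFinsupp_countable_support D).to_subtype
    refine exists_hasFiniteLogMeasure_forall_sum_le (fun i => abs_nonneg _)
      (fun i => norm_nonneg _) hp hq hR1 hC0 fun r hr S hS => ?_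
    have := hcount r hr (S.map (Function.Embedding.subtype _)) (by
      intro a ha
      obtain ⟨i, hi, rfl⟩ := Finset.mem_map.1 ha
      exact hS i hi)
    simpa using this
  obtain ⟨r₂, hr₂⟩ := Filter.eventually_atTop.1
    ((tendsto_rpow_atTop (by linarith : 0 < 1 - (p + 2 * q))).eventually_ge_atTop 2)
  -- The sum of the bounds `hpart1` (harmonic part) and `hpart2` (zeros and poles).
  set L : ℝ := 8 * (2 + K) * 4 ^ p + 4 * C * 4 ^ p + 1 with hL
  refine ⟨E, hE1, hE, exp L, max (max R r₂) 2, fun z hz hzE w hw => ?_⟩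
  set r := ‖z‖ with hr
  have hrR : R ≤ r := (le_max_left _ _).trans ((le_max_left _ _).trans hz)
  have hr2 : 2 ≤ r := (le_max_right _ _).trans hz
  have hr0 : 0 < r := by linarith
  set Q : ℝ := r ^ (1 - (p + 2 * q)) with hQ
  have hQ2 : 2 ≤ Q := hr₂ r ((le_max_right _ _).trans ((le_max_left _ _).trans hz))
  have hQr : Q ≤ r := by
    calc Q ≤ r ^ (1 : ℝ) := rpow_le_rpow_of_exponent_le (by linarith) (by linarith)
      _ = r := rpow_one r
  have hQinv : r ^ (p + 2 * q - 1) = Q⁻¹ := by rw [hQ, ← rpow_neg hr0.le]; congr 1; ring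
  have hQp : Q * r ^ p ≤ r := by
    rw [hQ, ← rpow_add hr0]
    calc _ ≤ r ^ (1 : ℝ) := rpow_le_rpow_of_exponent_le (by linarith) (by linarith)
      _ = r := rpow_one r
  have hfinS : {a : ℂ | D a ≠ 0 ∧ ‖a‖ ≤ 4 * r}.Finite := by
    refine ((Function.locallyFinsupp.locallyFiniteSupport D).finite_inter_support_of_isCompact
      (isCompact_closedBall (0 : ℂ) (4 * r))).subset fun a ha => ⟨?_, ha.1⟩
    simpa using ha.2
  set S : Finset ℂ := hfinS.toFinset with hSdef
  have hS : ∀ a, a ∈ S ↔ D a ≠ 0 ∧ ‖a‖ ≤ 4 * r := fun a => by simp [hSdef]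
  have hsum : ∑ a ∈ S, |(D a : ℝ)| / (1 + |r - ‖a‖|) ≤ Q⁻¹ := by
    have h1 := hEsum r (by linarith) hzE (S.subtype (· ∈ D.support)) (fun i hi =>
      ((hS i).1 (Finset.mem_subtype.1 hi)).2)
    rw [hQinv] at h1
    rwa [Finset.sum_subtype_of_mem (p := (· ∈ D.support))
      (fun a : ℂ => |(D a : ℝ)| / (1 + |r - ‖a‖|)) (fun a ha => ((hS a).1 ha).1)] at h1
  -- One term of `hsum` already gives `1 + |r - ‖a‖| ≥ Q`, and `Q - 1 ≥ Q / 2` because `Q ≥ 2`.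
  have hsep : ∀ a, D a ≠ 0 → ‖a‖ ≤ 4 * r → Q / 2 ≤ |r - ‖a‖| := by
    intro a ha har
    have h1 := (Finset.single_le_sum (f := fun a => |(D a : ℝ)| / (1 + |r - ‖a‖|))
      (fun i _ => by positivity) ((hS a).2 ⟨ha, har⟩)).trans hsum
    have h2 : (1 : ℝ) ≤ |(D a : ℝ)| := by exact_mod_cast Int.one_le_abs ha
    have h3 : 1 / (1 + |r - ‖a‖|) ≤ Q⁻¹ := le_trans (by gcongr) h1
    rw [one_div] at h3
    have := (inv_le_inv₀ (by positivity) (by positivity)).1 h3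
    linarith
  have hza : ∀ a, |r - ‖a‖| ≤ ‖z - a‖ := fun a => abs_norm_sub_norm_le z a
  have hord : ∀ v, ‖v - z‖ ≤ Q / 4 → meromorphicOrderAt g v = 0 := by
    intro v hv
    by_contra h
    have h1 : ‖v‖ ≤ 4 * r := by
      have := norm_sub_norm_le v z
      linarith
    have h2 := (hsep v ((hDne v).2 h) h1).trans (hza v)
    rw [norm_sub_rev] at h2
    linarith
  refine ⟨hord w hw, ?_⟩
  have hz0 : meromorphicOrderAt g z = 0 := hord z (by simp; linarith)
  have hw0 := hord w hw
  -- `ρ > 3r` puts `z` and `w` in the half disk, as `‖w‖ ≤ 5r / 4`; `ρ < 4r` keeps all relevant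
  -- zeros and poles in `S`.
  obtain ⟨ρ, ⟨hρ3, hρ4⟩, hρs⟩ := exists_sphere_meromorphicOrderAt_eq_zero hm hfin
    (show 3 * r < 4 * r by linarith)
  have hρ0 : 0 < ρ := by linarith
  have hwn : ‖w‖ ≤ ρ / 2 := by
    have := norm_sub_norm_le w z
    linarith
  have hwz0 := norm_nonneg (w - z)
  have key := log_norm_sub_log_norm_le hg hρ0 hfin hρs (show ‖z‖ ≤ ρ / 2 by linarith) hwn hz0 hw0
    (by linarith)
    (fun a ha h => by linarith [(hsep a ((hDne a).2 h) (by linarith)).trans (hza a)])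
    S (fun a ha h => (hS a).2 ⟨(hDne a).2 h, by linarith⟩)
  have hρp : ρ ^ p ≤ 4 ^ p * r ^ p := by
    rw [← mul_rpow (by norm_num) hr0.le]
    exact rpow_le_rpow hρ0.le hρ4.le hp
  have hwρ : ‖w - z‖ / ρ ≤ Q / r := by
    rw [div_le_div_iff₀ hρ0 hr0]
    nlinarith
  have hwρp : ‖w - z‖ / ρ * (4 ^ p * r ^ p) ≤ 4 ^ p := by
    calc _ ≤ Q / r * (4 ^ p * r ^ p) := by gcongr
      _ = 4 ^ p * (Q * r ^ p / r) := by ring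
      _ ≤ 4 ^ p * 1 := by gcongr; rw [div_le_one hr0]; exact hQp
      _ = 4 ^ p := mul_one _
  have hprox : ValueDistribution.proximity g ⊤ ρ + ValueDistribution.proximity g⁻¹ ⊤ ρ
      ≤ (2 + K) * (4 ^ p * r ^ p) := by
    have h1 := proximity_add_proximity_inv_le hm (r := ρ) (by linarith)
    have h2 := hT ρ (by linarith [le_max_left r₀ 1])
    have h3 : 1 ≤ 4 ^ p * r ^ p := (one_le_rpow (by linarith : 1 ≤ ρ) hp).trans hρp
    nlinarith
  have hpart1 : 8 * ‖w - z‖ / ρ *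
      (ValueDistribution.proximity g ⊤ ρ + ValueDistribution.proximity g⁻¹ ⊤ ρ)
      ≤ 8 * (2 + K) * 4 ^ p := by
    calc _ ≤ 8 * ‖w - z‖ / ρ * ((2 + K) * (4 ^ p * r ^ p)) := by gcongr
      _ = 8 * (2 + K) * (‖w - z‖ / ρ * (4 ^ p * r ^ p)) := by ring
      _ ≤ _ := by gcongr
  have hterm : ∀ a ∈ S, |(divisor g (ball 0 ρ) a : ℝ)|
      * (4 * ‖w - z‖ / ρ + 2 * ‖w - z‖ / ‖z - a‖)
      ≤ 4 * (‖w - z‖ / ρ) * |(D a : ℝ)| + 4 * ‖w - z‖ * (|(D a : ℝ)| / (1 + |r - ‖a‖|)) := by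
    intro a ha
    have h1 : |(divisor g (ball 0 ρ) a : ℝ)| ≤ |(D a : ℝ)| := by
      by_cases hab : a ∈ ball (0 : ℂ) ρ
      · rw [hD, hm.meromorphicOn.divisor_apply hab,
          hm.meromorphicOn.divisor_apply (Set.mem_univ a)]
      · rw [Function.locallyFinsuppWithin.apply_eq_zero_of_notMem _ hab]
        simp
    have h2 := hsep a ((hS a).1 ha).1 ((hS a).1 ha).2
    have h3 : 2 * ‖w - z‖ / ‖z - a‖ ≤ 4 * ‖w - z‖ / (1 + |r - ‖a‖|) := by
      have h4 := hza a
      rw [div_le_div_iff₀ (by linarith) (by positivity)]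
      nlinarith
    calc _ ≤ |(D a : ℝ)| * (4 * ‖w - z‖ / ρ + 4 * ‖w - z‖ / (1 + |r - ‖a‖|)) := by gcongr
      _ = _ := by ring
  have hpart2 : ∑ a ∈ S, |(divisor g (ball 0 ρ) a : ℝ)|
      * (4 * ‖w - z‖ / ρ + 2 * ‖w - z‖ / ‖z - a‖) ≤ 4 * C * 4 ^ p + 1 := by
    refine (Finset.sum_le_sum hterm).trans ?_
    rw [Finset.sum_add_distrib, ← Finset.mul_sum, ← Finset.mul_sum]
    have h1 := hcount (4 * r) (by linarith) S (fun a ha => ((hS a).1 ha).2)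
    rw [mul_rpow (by norm_num) hr0.le] at h1
    refine add_le_add ?_ ?_
    · calc _ ≤ 4 * (‖w - z‖ / ρ) * (C * (4 ^ p * r ^ p)) := by gcongr
        _ = 4 * C * (‖w - z‖ / ρ * (4 ^ p * r ^ p)) := by ring
        _ ≤ _ := by gcongr
    · calc _ ≤ Q * Q⁻¹ := by
            refine mul_le_mul (by linarith) hsum (Finset.sum_nonneg fun i _ => by positivity)
              (by linarith)
        _ = 1 := mul_inv_cancel₀ (by linarith)
  have hne : ∀ v, meromorphicOrderAt g v = 0 → 0 < ‖g v‖ := fun v hv =>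
    norm_pos_iff.2 ((hg (Set.mem_univ v)).meromorphicOrderAt_eq_zero_iff.1 hv)
  have hfinal : log ‖g w‖ ≤ L + log ‖g z‖ := by
    have := (le_abs_self _).trans key
    linarith
  rw [← log_le_log_iff (hne w hw0) (mul_pos (exp_pos _) (hne z hz0)),
    log_mul (exp_pos _).ne' (hne z hz0).ne', log_exp]
  exact hfinal

/-! ### Exceptional sets, order of growth, normal form, and the conclusion. -/

theorem HasFiniteLogMeasure.union {E F : Set ℝ} (hE : HasFiniteLogMeasure E)
    (hF : HasFiniteLogMeasure F) : HasFiniteLogMeasure (E ∪ F) :=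
  ⟨hE.1.union hF.1, (lintegral_union_le _ _ _).trans_lt (ENNReal.add_lt_top.2 ⟨hE.2, hF.2⟩)⟩

theorem Set.Countable.hasFiniteLogMeasure {E : Set ℝ} (hE : E.Countable) :
    HasFiniteLogMeasure E :=
  ⟨hE.measurableSet, by
    rw [setLIntegral_measure_zero _ _ (hE.measure_zero volume)]
    exact ENNReal.zero_lt_top⟩

theorem hasFiniteLogMeasure_Ioc (b : ℝ) : HasFiniteLogMeasure (Set.Ioc 1 b) := by
  refine ⟨measurableSet_Ioc, ?_⟩
  calc _ ≤ ∫⁻ _ in Set.Ioc 1 b, 1 := by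
        refine setLIntegral_mono' measurableSet_Ioc fun t ht => ?_
        rw [← ENNReal.ofReal_one]
        exact ENNReal.ofReal_le_ofReal ((div_le_one (by linarith [ht.1])).2 ht.1.le)
    _ < ⊤ := by simp

theorem nevanlinnaOrder_nonneg (f : ℂ → ℂ) : 0 ≤ nevanlinnaOrder f := by
  refine Filter.le_limsup_of_frequently_le (Filter.Eventually.frequently ?_)
  filter_upwards [Filter.eventually_ge_atTop 1] with r hr
  exact_mod_cast div_nonneg posLog_nonneg (log_nonneg hr)

theorem exists_characteristic_le_rpow {f : ℂ → ℂ} {p : ℝ} (h : nevanlinnaOrder f < (p : EReal)) :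
    ∃ r₀, ∀ r, r₀ ≤ r → ValueDistribution.characteristic f ⊤ r ≤ r ^ p := by
  refine Filter.eventually_atTop.1 ?_
  filter_upwards [Filter.eventually_lt_of_limsup_lt h, Filter.eventually_gt_atTop 1] with r hr hr1
  have hlog := log_pos hr1
  have h1 : posLog (ValueDistribution.characteristic f ⊤ r) < p * log r := by
    rw [← div_lt_iff₀ hlog]
    exact_mod_cast hr
  rcases le_or_gt (ValueDistribution.characteristic f ⊤ r) 0 with h0 | h0
  · exact h0.trans (rpow_nonneg (by linarith) _)
  · rw [← log_le_log_iff h0 (rpow_pos_of_pos (by linarith) _), log_rpow (by linarith)]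
    exact (le_max_right _ _).trans h1.le

theorem toMeromorphicNFOn_univ_apply {f : ℂ → ℂ} (hf : Meromorphic f) {z : ℂ}
    (hz : AnalyticAt ℂ f z) : toMeromorphicNFOn f Set.univ z = f z := by
  rw [toMeromorphicNFOn_eq_toMeromorphicNFAt hf.meromorphicOn (Set.mem_univ z),
    toMeromorphicNFAt_eq_self.2 hz.meromorphicNFAt]

theorem toMeromorphicNFOn_univ_eventuallyEq {f : ℂ → ℂ} (hf : Meromorphic f) {z : ℂ}
    (hz : AnalyticAt ℂ f z) : toMeromorphicNFOn f Set.univ =ᶠ[nhds z] f := by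
  filter_upwards [hz.eventually_analyticAt] with w hw
  exact toMeromorphicNFOn_univ_apply hf hw

/-- Identity theorem: infinite order at one point spreads over the connected plane, forcing `f` to
vanish wherever it is analytic. -/
theorem meromorphicOrderAt_ne_top_of_not_eventuallyEq {f : ℂ → ℂ} (hf : Meromorphic f)
    (hf0 : ¬ f =ᶠ[Filter.codiscrete ℂ] 0) (z : ℂ) : meromorphicOrderAt f z ≠ ⊤ := by
  have hm : MeromorphicOn f Set.univ := hf.meromorphicOn
  by_contra hz
  apply hf0
  have hall : ∀ u, meromorphicOrderAt f u = ⊤ := by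
    intro u
    by_contra hu
    exact (hm.exists_meromorphicOrderAt_ne_top_iff_forall isConnected_univ).1 ⟨⟨u, trivial⟩, hu⟩
      ⟨z, trivial⟩ hz
  filter_upwards [hm.analyticAt_mem_codiscreteWithin] with u hu
  have := hall u
  rw [meromorphicOrderAt_eq_top_iff] at this
  exact (hu.frequently_zero_iff_eventually_zero.1 this.frequently).self_of_nhds

theorem theorem5p2 (f : ℂ → ℂ) (hf : Meromorphic f)
    (hf0 : ¬ f =ᶠ[Filter.codiscrete ℂ] 0)
    (σ : ℝ) (hσ : nevanlinnaOrder f = (σ : EReal)) (hσ1 : σ < 1)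
    (η : ℂ) (hη : η ≠ 0) (ε : ℝ) (hε : 0 < ε) (k : ℕ) :
    ∃ E : Set ℝ, E ⊆ Set.Ioi 1 ∧ HasFiniteLogMeasure E ∧
      ∃ C : ℝ, ∀ z : ℂ, ‖z‖ ∉ E ∪ Set.Icc 0 1 →
        f z ≠ 0 ∧ (∀ j : ℕ, j ≤ k → AnalyticAt ℂ f (z + j * η)) ∧
        ‖((fwdDiff η)^[k] f) z / f z - η ^ k * (iteratedDeriv k f z / f z)‖
          ≤ C * ‖z‖ ^ (((k : ℝ) + 1) * (σ - 1) + ε) := by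
  have hσ0 : 0 ≤ σ := by
    have := nevanlinnaOrder_nonneg f
    rw [hσ] at this
    exact_mod_cast this
  have hk1 : (0 : ℝ) < k + 1 := by positivity
  -- The exponent loses `3 * q` in all: one `q` in `T(r) ≤ r ^ (σ + q)`, two in the exceptional set.
  obtain ⟨q, hq, hq1, hq2⟩ : ∃ q : ℝ, 0 < q ∧ σ + 3 * q < 1 ∧ (k + 1) * (3 * q) ≤ ε := by
    refine ⟨min ((1 - σ) / 4) (ε / ((k + 1) * 3)), lt_min (by linarith) (by positivity), ?_, ?_⟩
    · linarith [min_le_left ((1 - σ) / 4) (ε / ((k + 1) * 3))]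
    · have := min_le_right ((1 - σ) / 4) (ε / ((k + 1) * 3))
      rw [le_div_iff₀ (by positivity)] at this
      linarith
  -- `f` may take arbitrary values at poles and removable singularities. Its normal form `g` has the
  -- same characteristic for `r ≠ 0` and agrees with `f` wherever `f` is analytic.
  set g := toMeromorphicNFOn f Set.univ with hg
  have hNF : MeromorphicNFOn g Set.univ := meromorphicNFOn_toMeromorphicNFOn f Set.univ
  have hfg : f =ᶠ[Filter.codiscrete ℂ] g := toMeromorphicNFOn_eqOn_codiscrete hf.meromorphicOn
  have hfin : ∀ z, meromorphicOrderAt g z ≠ ⊤ := by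
    intro z
    rw [hg, meromorphicOrderAt_toMeromorphicNFOn hf.meromorphicOn (Set.mem_univ z)]
    exact meromorphicOrderAt_ne_top_of_not_eventuallyEq hf hf0 z
  obtain ⟨r₀, hr₀⟩ := exists_characteristic_le_rpow (f := f) (p := σ + q)
    (by rw [hσ]; exact_mod_cast (by linarith : σ < σ + q))
  obtain ⟨E, hE1, hE, M, r₁, hM⟩ := exists_forall_norm_le_mul_norm hNF hfin (p := σ + q) (q := q)
    (r₀ := max r₀ 1) (by linarith) hq (by linarith) (fun r hr => by
      rw [← ValueDistribution.characteristic_congr_codiscrete hfg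
        (by linarith [le_max_right r₀ 1])]
      exact hr₀ r ((le_max_left _ _).trans hr))
  -- Makes `k * ‖η‖ ≤ Q / 8`, half the radius of the comparison disk.
  obtain ⟨r₂, hr₂⟩ := Filter.eventually_atTop.1
    ((tendsto_rpow_atTop (by linarith : 0 < 1 - (σ + q + 2 * q))).eventually_ge_atTop
      (8 * (k * ‖η‖)))
  -- Radii for which some `z + jη` can be a point of non-analyticity of `f`, removable ones
  -- included; a countable set, hence null.
  set B : Set ℝ := ⋃ j : ℕ, (fun b : ℂ => ‖b - j * η‖) '' {b | AnalyticAt ℂ f b}ᶜ with hB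
  have hBc : B.Countable := by
    refine Set.countable_iUnion fun j => Set.Countable.image ?_ _
    simpa using (hf.meromorphicOn (s := Set.univ)).countable_compl_analyticAt_inter
  refine ⟨E ∪ (Set.Ioc 1 (max r₁ r₂) ∪ B ∩ Set.Ioi 1), ?_, ?_, ?_⟩
  · exact Set.union_subset hE1 (Set.union_subset (fun x hx => hx.1) Set.inter_subset_right)
  · exact hE.union ((hasFiniteLogMeasure_Ioc _).union
      (hBc.mono Set.inter_subset_left).hasFiniteLogMeasure)
  refine ⟨2 ^ (k + 1) * M * (4 * (k * ‖η‖)) ^ (k + 1), fun z hz => ?_⟩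
  simp only [Set.mem_union, not_or, Set.mem_Icc, norm_nonneg, true_and, not_le, Set.mem_Ioc,
    Set.mem_inter_iff, Set.mem_Ioi, not_and] at hz
  obtain ⟨⟨hzE, hzr, hzB⟩, hz1⟩ := hz
  have hzr' := hzr hz1
  have han : ∀ j : ℕ, AnalyticAt ℂ f (z + j * η) := by
    intro j
    by_contra h
    exact hzB (Set.mem_iUnion.2 ⟨j, z + j * η, h, by simp⟩) hz1
  have hfgz : ∀ j : ℕ, g (z + j * η) = f (z + j * η) := fun j =>
    toMeromorphicNFOn_univ_apply hf (han j)
  have hz0 : AnalyticAt ℂ f z := by simpa using han 0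
  have hgz : g z = f z := toMeromorphicNFOn_univ_apply hf hz0
  have hpos : 0 < ‖z‖ := by linarith
  set s : ℝ := σ + q + 2 * q with hs
  set Q : ℝ := ‖z‖ ^ (1 - s) with hQ
  have hQ0 : 0 < Q := rpow_pos_of_pos hpos _
  have hball := hM z ((le_max_left _ _).trans hzr'.le) hzE
  have hgan : ∀ w ∈ closedBall z (Q / 4), AnalyticAt ℂ g w := fun w hw =>
    (hNF (Set.mem_univ w)).meromorphicOrderAt_nonneg_iff_analyticAt.1
      (hball w (mem_closedBall_iff_norm.1 hw)).1.ge
  have hgz0 : g z ≠ 0 := (hNF (Set.mem_univ z)).meromorphicOrderAt_eq_zero_iff.1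
    (hball z (by simp; positivity)).1
  have hfz0 : f z ≠ 0 := hgz ▸ hgz0
  refine ⟨hfz0, fun j _ => han j, ?_⟩
  have hdiff : (fwdDiff η)^[k] f z = (fwdDiff η)^[k] g z := by
    rw [fwdDiff_iter_eq_sum_shift, fwdDiff_iter_eq_sum_shift]
    refine Finset.sum_congr rfl fun j _ => ?_
    rw [nsmul_eq_mul, hfgz j]
  have hder : iteratedDeriv k f z = iteratedDeriv k g z :=
    ((toMeromorphicNFOn_univ_eventuallyEq hf hz0).iteratedDeriv_eq k).symm
  have hDC : DiffContOnCl ℂ g (ball z (Q / 4)) := by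
    refine DifferentiableOn.diffContOnCl ?_
    rw [closure_ball z (by positivity)]
    exact fun w hw => (hgan w hw).differentiableAt.differentiableWithinAt
  have hkQ : k * ‖η‖ ≤ Q / 4 / 2 := by
    have := hr₂ ‖z‖ ((le_max_right _ _).trans hzr'.le)
    linarith
  have hest := norm_fwdDiff_iter_sub_le (η := η) (M := M * ‖g z‖) k (by positivity) hDC
    (fun w hw => (hball w (mem_sphere_iff_norm.1 hw).le).2) hkQ
  have hM0 : 0 ≤ M := by
    have := (hball z (by simp; positivity)).2
    have h0 : 0 < ‖g z‖ := norm_pos_iff.2 hgz0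
    nlinarith
  rw [← mul_div_assoc, ← sub_div, norm_div, hdiff, hder, ← hgz,
    div_le_iff₀ (norm_pos_iff.2 hgz0)]
  have hQpow : (Q⁻¹) ^ (k + 1) ≤ ‖z‖ ^ (((k : ℝ) + 1) * (σ - 1) + ε) := by
    rw [hQ, ← rpow_neg hpos.le, ← rpow_natCast, ← rpow_mul hpos.le]
    refine rpow_le_rpow_of_exponent_le hz1.le ?_
    push_cast
    rw [hs]
    linarith
  calc _ ≤ 2 ^ (k + 1) * (M * ‖g z‖) * (k * ‖η‖ / (Q / 4)) ^ (k + 1) := hest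
    _ = 2 ^ (k + 1) * M * (4 * (k * ‖η‖)) ^ (k + 1) * (Q⁻¹) ^ (k + 1) * ‖g z‖ := by
        rw [show k * ‖η‖ / (Q / 4) = 4 * (k * ‖η‖) * Q⁻¹ by field_simp, mul_pow]
        ring
    _ ≤ _ := by gcongr
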